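/- Let $K$ be a field, $S=K[x_1,\dots,x_n]$ with its standard $\mathbb{Z}^n$-grading, and let $I_{n,d}\subset S$ be the squarefree Veronese ideal, generated by all squarefree monomials of degree $d$. A Stanley decomposition of a nonzero monomial ideal $I\subseteq S$ is a representation $\mathcal{D}\colon I=\bigoplus_{i=1}^m u_iK[Z_i]$ as a finite direct sum of $K$-vector spaces, where each $u_i\in I$ is nonzero and $\mathbb{Z}^n$-homogeneous and each $Z_i\subseteq\{x_1,\dots,x_n\}$. Put $\operatorname{sdepth}(\mathcal{D})=\min_{1\le i\le m}|Z_i|$, and let the Stanley depth $\operatorname{sdepth}(I)$ be the maximum of $\operatorname{sdepth}(\mathcal{D})$ over all Stanley decompositions $\mathcal{D}$ of $I$. (1) If $1\le d\le n<5d+4$, then $$\operatorname{sdepth}(I_{n,d})=\left\lfloor \binom{n}{d+1}\Big/\binom{n}{d}\right\rfloor+d.$$ (2) If $d\ge 1$ and $n\ge 5d+4$, then $$d+3\le\operatorname{sdepth}(I_{n,d})\le\left\lfloor \binom{n}{d+1}\Big/\binom{n}{d}\right\rfloor+d.$$ -/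

import Mathlib

namespace StanleyDepth

variable {K : Type*} [Field K] {n : ℕ}

/-- `f` is a homogeneous element of `S = K[x_1, …, x_n]` for the `ℤ^n`-grading of `S`, in which
`x_i` has degree the `i`-th standard basis vector of `ℤ^n`. -/
def IsMultihomogeneous (f : MvPolynomial (Fin n) K) : Prop :=
  ∃ a : Fin n → ℤ,
    MvPolynomial.IsWeightedHomogeneous (fun i : Fin n => (Pi.single i 1 : Fin n → ℤ)) f a

/-- The `K`-vector subspace `u K[Z] = {u * g | g ∈ K[Z]}` of `S = K[x_1, …, x_n]`, where `Z` is a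
set of variables (given by their indices) and `K[Z]` is the subalgebra they generate. -/
noncomputable def stanleySpace (u : MvPolynomial (Fin n) K) (Z : Finset (Fin n)) :
    Submodule K (MvPolynomial (Fin n) K) :=
  (Subalgebra.toSubmodule (MvPolynomial.supported K (Z : Set (Fin n)))).map
    (LinearMap.mulLeft K u)

/-- A Stanley decomposition of an ideal `I` of `S = K[x_1, …, x_n]`: a representation
`I = ⨁_{i=1}^m u_i K[Z_i]` as a finite direct sum of `K`-vector spaces, with `u_i ∈ I` homogeneous
for the `ℤ^n`-grading and `Z_i` a set of variables. As `S` is a domain, `u_i ≠ 0` says exactly that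
`u_i K[Z_i]` is a free `K[Z_i]`-module of rank one, as is understood in the notation. -/
structure StanleyDecomposition (I : Ideal (MvPolynomial (Fin n) K)) where
  m : ℕ
  u : Fin m → MvPolynomial (Fin n) K
  Z : Fin m → Finset (Fin n)
  mem : ∀ i, u i ∈ I
  ne_zero : ∀ i, u i ≠ 0
  homogeneous : ∀ i, IsMultihomogeneous (u i)
  independent : iSupIndep fun i => stanleySpace (u i) (Z i)
  iSup_eq : ⨆ i, stanleySpace (u i) (Z i) = I.restrictScalars K

/-- The Stanley depth of a decomposition: the minimum of the `|Z_i|`. (Only the zero ideal has a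
decomposition without summands.) -/
noncomputable def StanleyDecomposition.sdepth {I : Ideal (MvPolynomial (Fin n) K)}
    (D : StanleyDecomposition I) : ℕ :=
  ⨅ i, (D.Z i).card

/-- The Stanley depth of an ideal: the maximum of the Stanley depths of its Stanley decompositions.
These are all at most `n`, so the supremum is a maximum as soon as a decomposition exists; it would
be `0` if there were none. -/
noncomputable def sdepth (I : Ideal (MvPolynomial (Fin n) K)) : ℕ :=
  sSup (Set.range fun D : StanleyDecomposition I => D.sdepth)

/-- The squarefree Veronese ideal `I_{n,d}` of `K[x_1, …, x_n]`, generated by all squarefree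
monomials of degree `d`. -/
noncomputable def squarefreeVeronese (K : Type*) [Field K] (n d : ℕ) :
    Ideal (MvPolynomial (Fin n) K) :=
  Ideal.span {f | ∃ s : Finset (Fin n), s.card = d ∧ f = ∏ i ∈ s, MvPolynomial.X i}

end StanleyDepth

/-! Lower bound. Sorting exponents by support turns a partition of the sets of size at least d into
intervals [A, B] into a Stanley decomposition with summands x^A K[B], so it suffices to achieve |B|
≥ d + k throughout. For n = (k+1)d + k, place the variables on a circle and give the points of a
d-set A weight k, the others weight -1. The total is -k, and a cycle-lemma argument (`card_gaps`)
finds exactly k gaps: points where every arc ending there has negative weight. The intervals [A, A ∪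
gaps] are pairwise disjoint (`eq_of_union_gaps`) and, by counting, contain all sets of size d + 1.
For k ≤ 3 the only uncovered sets that are too small have size d + 2, with k = 3; they are matched
with uncovered supersets of size d + 3 (`GapCovered.of_insert`). Larger n follow by a Pascal-type
recursion.

Upper bound. Each squarefree monomial x^A of degree d generates its own summand, with variables Z.
The sets A ∪ {x}, x ∈ Z \ A, are distinct for all pairs (A, x), which bounds the smallest |Z| - d by
the ratio of binomials. That ratio is (n-d)/(d+1), whose floor is the largest k with (k+1)d + k ≤ n.
-/

namespace StanleyDepth

/-! ### Gaps of a subset of the circle -/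

section Cyclic

open Finset

variable {n : ℕ}

/-- The number of elements of `A` among the `m` points `x, x - 1, …, x - (m - 1)` of the circle. -/
def arcCount (A : Finset (ZMod n)) (x : ZMod n) (m : ℕ) : ℕ :=
  ((range m).filter fun j : ℕ => x - (j : ZMod n) ∈ A).card

theorem arcCount_eq_sum (A : Finset (ZMod n)) (x : ZMod n) (m : ℕ) :
    arcCount A x m = ∑ j ∈ range m, if x - (j : ZMod n) ∈ A then 1 else 0 := by
  simp [arcCount]

theorem arcCount_zero (A : Finset (ZMod n)) (x : ZMod n) : arcCount A x 0 = 0 := by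
  simp [arcCount]

theorem arcCount_add (A : Finset (ZMod n)) (x : ZMod n) (m l : ℕ) :
    arcCount A x (m + l) = arcCount A x m + arcCount A (x - m) l := by
  simp only [arcCount_eq_sum, sum_range_add, Nat.cast_add, sub_sub]

theorem arcCount_one (A : Finset (ZMod n)) (x : ZMod n) :
    arcCount A x 1 = if x ∈ A then 1 else 0 := by
  rw [arcCount_eq_sum, sum_range_one, Nat.cast_zero, sub_zero]

/-- The largest excess of an arc ending in `x`. -/
def maxExcess (k : ℕ) (A : Finset (ZMod n)) (x : ZMod n) : ℤ :=
  (range (n + 1)).sup' ⟨0, by simp⟩ fun m => ((k : ℤ) + 1) * arcCount A x m - m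

theorem le_maxExcess (k : ℕ) (A : Finset (ZMod n)) (x : ZMod n) {m : ℕ} (hm : m ≤ n) :
    ((k : ℤ) + 1) * arcCount A x m - m ≤ maxExcess k A x :=
  le_sup' (fun m : ℕ => ((k : ℤ) + 1) * arcCount A x m - m) (mem_range.2 (by omega))

theorem exists_maxExcess (k : ℕ) (A : Finset (ZMod n)) (x : ZMod n) :
    ∃ m ≤ n, maxExcess k A x = ((k : ℤ) + 1) * arcCount A x m - m := by
  obtain ⟨m, hm, h⟩ := exists_mem_eq_sup' (s := range (n + 1)) ⟨0, by simp⟩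
    fun m : ℕ => ((k : ℤ) + 1) * arcCount A x m - m
  exact ⟨m, by simpa [Nat.lt_succ_iff] using hm, h⟩

variable [NeZero n]

/-- The gaps of `A`: the points `x` such that every arc ending in `x` has more than `k + 1` times as
many points as it has elements of `A`. -/
noncomputable def gaps (k : ℕ) (A : Finset (ZMod n)) : Finset (ZMod n) :=
  open Classical in
  univ.filter fun x => ∀ m ∈ Icc 1 n, (k + 1) * arcCount A x m < m

theorem mem_gaps {k : ℕ} {A : Finset (ZMod n)} {x : ZMod n} :
    x ∈ gaps k A ↔ ∀ m, 1 ≤ m → m ≤ n → (k + 1) * arcCount A x m < m := by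
  simp [gaps]

theorem arcCount_full (A : Finset (ZMod n)) (x : ZMod n) : arcCount A x n = A.card := by
  refine card_bij' (fun j _ => x - (j : ZMod n)) (fun a _ => (x - a).val) ?_ ?_ ?_ ?_
  · intro j hj
    exact (mem_filter.1 hj).2
  · intro a ha
    simp [ZMod.val_lt, ha]
  · intro j hj
    have := (mem_filter.1 hj).1
    simp only [sub_sub_cancel]
    exact ZMod.val_cast_of_lt (mem_range.1 this)
  · intro a ha
    simp

theorem notMem_of_mem_gaps {k : ℕ} {A : Finset (ZMod n)} {x : ZMod n} (h : x ∈ gaps k A) :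
    x ∉ A := by
  intro hx
  have := mem_gaps.1 h 1 le_rfl (NeZero.one_le)
  simp [arcCount_one, hx] at this

theorem disjoint_gaps (k : ℕ) (A : Finset (ZMod n)) : Disjoint A (gaps k A) :=
  disjoint_right.2 fun _ => notMem_of_mem_gaps

/-- With weight w = k on `A` and w = -1 elsewhere, the maximal excess H satisfies H(x) = max(0, w(x)
+ H(x-1)). The second entry is negative exactly at the gaps, where it equals -1; this is the
correction term. -/
theorem maxExcess_sub {k : ℕ} {A : Finset (ZMod n)} (hA : (k + 1) * A.card ≤ n) (x : ZMod n) :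
    maxExcess k A x - maxExcess k A (x - 1) =
      ((k : ℤ) + 1) * (if x ∈ A then 1 else 0) - 1 + if x ∈ gaps k A then 1 else 0 := by
  have hstep (m : ℕ) : (arcCount A x (m + 1) : ℤ) =
      (if x ∈ A then 1 else 0) + arcCount A (x - 1) m := by
    rw [add_comm m 1, arcCount_add, arcCount_one]
    push_cast
    simp
  have h0 : 0 ≤ maxExcess k A x := by simpa [arcCount_zero] using le_maxExcess k A x (Nat.zero_le n)
  have h0' : 0 ≤ maxExcess k A (x - 1) := by
    simpa [arcCount_zero] using le_maxExcess k A (x - 1) (Nat.zero_le n)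
  -- By `hA` the full circle has excess at most 0, so the empty arc can replace it; the arc then has
  -- room to be extended by `x`.
  obtain ⟨m', hm', hH'⟩ : ∃ m < n,
      maxExcess k A (x - 1) = ((k : ℤ) + 1) * arcCount A (x - 1) m - m := by
    obtain ⟨m, hm, h⟩ := exists_maxExcess k A (x - 1)
    rcases hm.lt_or_eq with hm | rfl
    · exact ⟨m, hm, h⟩
    · refine ⟨0, NeZero.pos _, ?_⟩
      rw [arcCount_full] at h
      have : ((k : ℤ) + 1) * A.card ≤ m := by exact_mod_cast hA
      simp only [arcCount_zero]
      push_cast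
      linarith
  have hlow := le_maxExcess k A x (m := m' + 1) hm'
  rw [hstep] at hlow
  push_cast at hlow
  obtain ⟨m, hm, hH⟩ := exists_maxExcess k A x
  by_cases hg : x ∈ gaps k A
  · have hxA := notMem_of_mem_gaps hg
    have h1 := mem_gaps.1 hg (m' + 1) (by omega) hm'
    have h1' : ((k : ℤ) + 1) * arcCount A x (m' + 1) < m' + 1 := by exact_mod_cast h1
    rw [hstep] at h1'
    have h2 : maxExcess k A x ≤ 0 := by
      rcases Nat.eq_zero_or_pos m with rfl | hpos
      · simp [hH, arcCount_zero]
      · have := mem_gaps.1 hg m hpos hm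
        have : ((k : ℤ) + 1) * arcCount A x m < m := by exact_mod_cast this
        omega
    simp only [hxA, hg, if_true, if_false] at *
    linarith
  · simp only [hg, if_false]
    have key : maxExcess k A x ≤
        ((k : ℤ) + 1) * (if x ∈ A then 1 else 0) - 1 + maxExcess k A (x - 1) := by
      obtain ⟨l, hl, hll⟩ : ∃ l < n, maxExcess k A x ≤
          ((k : ℤ) + 1) * arcCount A x (l + 1) - (l + 1 : ℕ) := by
        rcases m with _ | m
        · rw [mem_gaps] at hg
          push Not at hg
          obtain ⟨l, h1, h2, h3⟩ := hg
          obtain ⟨l, rfl⟩ : ∃ l', l = l' + 1 := ⟨l - 1, by omega⟩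
          refine ⟨l, by omega, ?_⟩
          have : ((l + 1 : ℕ) : ℤ) ≤ ((k : ℤ) + 1) * arcCount A x (l + 1) := by exact_mod_cast h3
          rw [hH, arcCount_zero]
          push_cast at *
          linarith
        · exact ⟨m, by omega, hH.le⟩
      have := le_maxExcess k A (x - 1) hl.le
      rw [hstep] at hll
      push_cast at hll
      linarith
    linarith

/-- Summing `maxExcess_sub` around the circle cancels the left side and leaves 0 = (k+1)d - n +
#gaps. -/
theorem card_gaps {k d : ℕ} (hn : n = (k + 1) * d + k) {A : Finset (ZMod n)} (hA : A.card = d) :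
    (gaps k A).card = k := by
  have hle : (k + 1) * A.card ≤ n := by rw [hA]; omega
  have h := sum_congr (rfl : (univ : Finset (ZMod n)) = univ) fun x _ => maxExcess_sub hle x
  have hshift := (Equiv.subRight (1 : ZMod n)).sum_comp (maxExcess k A)
  simp only [Equiv.subRight_apply] at hshift
  rw [sum_sub_distrib, hshift, sub_self, sum_add_distrib, sum_sub_distrib, ← mul_sum] at h
  simp only [sum_boole, filter_univ_mem, sum_const, card_univ, ZMod.card, hA] at h
  have : (n : ℤ) = (k + 1) * d + k := by exact_mod_cast hn
  simp at h
  linarith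

/-- If A ≠ A', a point of A' \ A is a gap of A and a point of A \ A' is a gap of A'. For a closest
such pair the two gap inequalities, on complementary arcs sharing only their endpoints, are
incompatible. -/
theorem eq_of_union_gaps {k d : ℕ} (hn : n = (k + 1) * d + k) {A A' R R' : Finset (ZMod n)}
    (hA : A.card = d) (hA' : A'.card = d) (hR : R ⊆ gaps k A) (hR' : R' ⊆ gaps k A')
    (h : A ∪ R = A' ∪ R') : A = A' := by
  have hd : Disjoint A R := (disjoint_gaps k A).mono_right hR
  have hd' : Disjoint A' R' := (disjoint_gaps k A').mono_right hR'
  by_contra hne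
  have h1 : (A' \ A).Nonempty := by
    rw [sdiff_nonempty]
    intro hs
    exact hne (eq_of_subset_of_card_le hs (by omega)).symm
  have h2 : (A \ A').Nonempty := by
    rw [sdiff_nonempty]
    intro hs
    exact hne (eq_of_subset_of_card_le hs (by omega))
  have hmem (x : ZMod n) : x ∈ A ∨ x ∈ R ↔ x ∈ A' ∨ x ∈ R' := by
    simpa using congrArg (x ∈ ·) h
  obtain ⟨⟨g, g'⟩, hp, hmin⟩ := exists_min_image ((A' \ A) ×ˢ (A \ A'))
    (fun p => (p.2 - p.1).val) (h1.product h2)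
  simp only [mem_product, mem_sdiff, Prod.forall] at hp hmin
  obtain ⟨⟨hgA', hgA⟩, hgA2, hgA2'⟩ := hp
  have hg : g ∈ gaps k A := hR (((hmem g).2 (Or.inl hgA')).resolve_left hgA)
  have hg' : g' ∈ gaps k A' := hR' (((hmem g').1 (Or.inl hgA2)).resolve_left hgA2')
  set j := (g' - g).val with hj
  have hjn : j < n := ZMod.val_lt _
  have hjc : (j : ZMod n) = g' - g := by simp [hj]
  obtain ⟨l, hl⟩ : ∃ l, j = l + 1 := by
    refine ⟨j - 1, ?_⟩
    have : j ≠ 0 := by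
      intro h0
      rw [h0, Nat.cast_zero, eq_comm, sub_eq_zero] at hjc
      exact hgA (hjc ▸ hgA2)
    omega
  -- A point strictly between `g` and `g'` where the two sets differ would form a closer pair with
  -- `g` or `g'`.
  have hagree : arcCount A (g' - 1) l = arcCount A' (g' - 1) l := by
    rw [arcCount_eq_sum, arcCount_eq_sum]
    refine sum_congr rfl fun i hi => ?_
    have hil : i < l := mem_range.1 hi
    set x := g' - 1 - (i : ZMod n) with hx
    have hx1 : g' - x = ((i + 1 : ℕ) : ZMod n) := by push_cast; rw [hx]; ring
    have hx2 : x - g = ((j - (i + 1) : ℕ) : ZMod n) := by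
      rw [Nat.cast_sub (by omega), hjc, ← hx1]; ring
    have hiff : x ∈ A ↔ x ∈ A' := by
      constructor
      · intro hxA
        by_contra hxA'
        have := hmin g x ⟨⟨hgA', hgA⟩, hxA, hxA'⟩
        rw [hx2, ZMod.val_cast_of_lt (by omega)] at this
        omega
      · intro hxA'
        by_contra hxA
        have := hmin x g' ⟨⟨hxA', hxA⟩, hgA2, hgA2'⟩
        rw [hx1, ZMod.val_cast_of_lt (by omega)] at this
        omega
    simp [hiff]
  have e1 : arcCount A g' j = 1 + arcCount A (g' - 1) l := by
    rw [hl, add_comm l, arcCount_add, arcCount_one]; simp [hgA2]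
  have e2 : arcCount A' g' (j + 1) = arcCount A' (g' - 1) l + 1 := by
    rw [arcCount_add, hl, add_comm l, arcCount_add, arcCount_one, arcCount_one]
    have : g' - ((1 + l : ℕ) : ZMod n) = g := by rw [add_comm, ← hl, hjc]; ring
    rw [this]
    simp [hgA2', hgA']
  have e3 : arcCount A g' j + arcCount A g (n - j) = d := by
    have := arcCount_add A g' j (n - j)
    rw [show j + (n - j) = n by omega, arcCount_full, hA, hjc] at this
    simpa using this.symm
  have e4 : arcCount A g (n - j + 1) = arcCount A g (n - j) + 1 := by
    rw [arcCount_add, arcCount_one]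
    have : g - ((n - j : ℕ) : ZMod n) = g' := by
      rw [Nat.cast_sub hjn.le, hjc]; simp
    rw [this]
    simp [hgA2]
  -- The two arcs have j + 1 and n - j + 1 points and counts adding up to d + 1. Adding the strict
  -- inequalities gives (k+1)(d+1) ≤ n, whereas n = (k+1)(d+1) - 1.
  have i1 := mem_gaps.1 hg' (j + 1) (by omega) (by omega)
  have i2 := mem_gaps.1 hg (n - j + 1) (by omega) (by omega)
  rw [e2] at i1
  rw [e4] at i2
  have e5 : arcCount A' (g' - 1) l + 1 + (arcCount A g (n - j) + 1) = d + 1 := by omega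
  have := congrArg ((k + 1) * ·) e5
  simp only [mul_add] at this i1 i2 hn ⊢
  omega

/-- Take for g the nearest gap preceding e. An arc ending in another gap meets e before it reaches
g, so moving e to g never raises its count. -/
theorem exists_exchange_gap {k : ℕ} {A : Finset (ZMod n)} (hG : (gaps k A).Nonempty)
    {e : ZMod n} (he : e ∈ A) :
    ∃ g ∈ gaps k A, (gaps k A).erase g ⊆ gaps k (insert g (A.erase e)) := by
  obtain ⟨g, hg, hmin⟩ := exists_min_image (gaps k A) (fun g => (e - g).val) hG
  refine ⟨g, hg, fun x hx => ?_⟩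
  obtain ⟨hxg, hx⟩ := mem_erase.1 hx
  refine mem_gaps.2 fun m hm1 hmn => lt_of_le_of_lt (Nat.mul_le_mul_left _ ?_)
    (mem_gaps.1 hx m hm1 hmn)
  have hxe : x ≠ e := fun h => notMem_of_mem_gaps hx (h ▸ he)
  by_cases hgm : (x - g).val < m
  · have hlt : (x - e).val < (x - g).val := by
      have h1 := hmin x hx
      by_contra hcon
      push Not at hcon
      have h2 : ((e - g).val : ℤ) = (e - x).val + (x - g).val ∨
          ((e - g).val : ℤ) = (e - x).val + (x - g).val - n := by
        have := ZMod.val_add (e - x) (x - g)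
        rw [sub_add_sub_cancel] at this
        rcases lt_or_ge ((e - x).val + (x - g).val) n with h | h
        · left; rw [this, Nat.mod_eq_of_lt h]; push_cast; rfl
        · right
          rw [this, Nat.mod_eq_sub_mod h, Nat.mod_eq_of_lt, Nat.cast_sub h]
          · push_cast; rfl
          · have := ZMod.val_lt (e - x); have := ZMod.val_lt (x - g); omega
      have h3 : (x - e).val = n - (e - x).val := by
        have : NeZero (e - x) := ⟨sub_ne_zero.2 hxe.symm⟩
        rw [← neg_sub, ZMod.val_neg_of_ne_zero]
      have h4 : (x - g).val ≠ 0 := by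
        rw [Ne, ZMod.val_eq_zero, sub_eq_zero]; exact hxg
      have h5 : (e - g).val ≠ 0 := by
        rw [Ne, ZMod.val_eq_zero, sub_eq_zero]
        exact fun h => notMem_of_mem_gaps hg (h ▸ he)
      have := ZMod.val_lt (e - x)
      omega
    -- The new set gains the position of `g` but loses that of `e`, which lies inside the arc by
    -- `hlt`.
    have hsub : ((range m).filter fun j : ℕ => x - (j : ZMod n) ∈ insert g (A.erase e)) ⊆
        insert (x - g).val
          (((range m).filter fun j : ℕ => x - (j : ZMod n) ∈ A).erase (x - e).val) := by
      intro j hj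
      simp only [mem_filter, mem_range, mem_insert, mem_erase] at hj ⊢
      obtain ⟨hjm, h | ⟨h, h'⟩⟩ := hj
      · left
        rw [← h, sub_sub_cancel, ZMod.val_cast_of_lt (by omega)]
      · right
        refine ⟨fun hje => h ?_, hjm, h'⟩
        rw [hje]; simp
    refine (card_le_card hsub).trans ((card_insert_le _ _).trans ?_)
    rw [card_erase_add_one]
    · rfl
    · simp only [mem_filter, mem_range]
      exact ⟨by omega, by simpa using he⟩
  · refine card_le_card fun j hj => ?_
    simp only [mem_filter, mem_range, mem_insert, mem_erase] at hj ⊢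
    obtain ⟨hjm, h | ⟨h, h'⟩⟩ := hj
    · exfalso
      apply hgm
      rw [← h, sub_sub_cancel, ZMod.val_cast_of_lt (by omega)]
      exact hjm
    · exact ⟨hjm, h'⟩

end Cyclic

/-! ### Interval partitions of the sets of size at least d -/

section IntervalPartition

open Finset

/-- The finite subsets of `α` with at least `d` elements are partitioned by finitely many intervals
`[A, B]` with `s ≤ |B|`. -/
def HasIntervalPartition (α : Type*) (d s : ℕ) : Prop :=
  ∃ 𝓘 : Finset (Finset α × Finset α),
    (∀ I ∈ 𝓘, I.1 ⊆ I.2 ∧ d ≤ I.1.card ∧ s ≤ I.2.card) ∧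
      ∀ C : Finset α, d ≤ C.card → ∃! I, I ∈ 𝓘 ∧ I.1 ⊆ C ∧ C ⊆ I.2

theorem HasIntervalPartition.congr {α β : Type*} (e : α ≃ β) {d s : ℕ}
    (h : HasIntervalPartition α d s) : HasIntervalPartition β d s := by
  obtain ⟨𝓘, h1, h2⟩ := h
  have hsub (A : Finset α) (C : Finset β) :
      (A.map e.toEmbedding ⊆ C ↔ A ⊆ C.map e.symm.toEmbedding) ∧
      (C ⊆ A.map e.toEmbedding ↔ C.map e.symm.toEmbedding ⊆ A) := by
    constructor
    · rw [← map_subset_map (f := e.toEmbedding) (s₂ := C.map _), map_map]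
      simp
    · rw [← map_subset_map (f := e.symm.toEmbedding) (s₂ := A.map _), map_map]
      simp
  refine ⟨𝓘.map (e.finsetCongr.prodCongr e.finsetCongr).toEmbedding, ?_, fun C hC => ?_⟩
  · intro I hI
    obtain ⟨J, hJ, rfl⟩ := mem_map.1 hI
    simpa using h1 J hJ
  · obtain ⟨J, ⟨hJ, hJ1, hJ2⟩, hu⟩ := h2 (C.map e.symm.toEmbedding) (by simpa using hC)
    refine ⟨(e.finsetCongr.prodCongr e.finsetCongr) J, ⟨mem_map_of_mem _ hJ, ?_, ?_⟩, ?_⟩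
    · exact (hsub _ _).1.2 hJ1
    · exact (hsub _ _).2.2 hJ2
    · rintro I ⟨hI, hI1, hI2⟩
      obtain ⟨J', hJ', rfl⟩ := mem_map.1 hI
      exact congrArg _ (hu J' ⟨hJ', (hsub _ _).1.1 hI1, (hsub _ _).2.1 hI2⟩)

theorem hasIntervalPartition_zero (α : Type*) [Fintype α] {s : ℕ} (hs : s ≤ Fintype.card α) :
    HasIntervalPartition α 0 s := by
  refine ⟨{(∅, univ)}, by simpa using hs, fun C _ => ⟨(∅, univ), by simp,
    fun I hI => by simpa using hI.1⟩⟩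

/-- The sets without the new point and the sets with it are partitioned separately. -/
theorem HasIntervalPartition.option {α : Type*} {d s : ℕ}
    (h1 : HasIntervalPartition α (d + 1) (s + 1)) (h2 : HasIntervalPartition α d s) :
    HasIntervalPartition (Option α) (d + 1) (s + 1) := by
  classical
  obtain ⟨𝓘, hI, hIu⟩ := h1
  obtain ⟨𝓙, hJ, hJu⟩ := h2
  have hsome (C : Finset (Option α)) (hC : none ∉ C) : ∃ D : Finset α, C = D.map .some :=
    ⟨eraseNone C, by rw [map_some_eraseNone, erase_eq_of_notMem hC]⟩
  have hinsert (C : Finset (Option α)) (hC : none ∈ C) : ∃ D : Finset α, C = insertNone D :=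
    ⟨eraseNone C, by rw [insertNone_eraseNone, insert_eq_of_mem hC]⟩
  have hss (A B : Finset α) : insertNone A ⊆ insertNone B ↔ A ⊆ B :=
    insertNone.le_iff_le
  refine ⟨𝓘.image (fun I => (I.1.map .some, I.2.map .some)) ∪
    𝓙.image (fun I => (insertNone I.1, insertNone I.2)), ?_, fun C hC => ?_⟩
  · intro I hmem
    rcases mem_union.1 hmem with h | h <;> obtain ⟨J, hJm, rfl⟩ := mem_image.1 h
    · simpa using hI J hJm
    · have := hJ J hJm
      refine ⟨(hss _ _).2 this.1, ?_, ?_⟩ <;> simp [card_insertNone, this]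
  · by_cases hn : none ∈ C
    · obtain ⟨D, rfl⟩ := hinsert C hn
      rw [card_insertNone] at hC
      obtain ⟨J, ⟨hJm, hJ1, hJ2⟩, hu⟩ := hJu D (by omega)
      refine ⟨(insertNone J.1, insertNone J.2), ⟨mem_union_right _ (mem_image_of_mem _ hJm),
        (hss _ _).2 hJ1, (hss _ _).2 hJ2⟩, ?_⟩
      rintro I ⟨hmem, hI1, hI2⟩
      rcases mem_union.1 hmem with h | h <;> obtain ⟨J', hJm', rfl⟩ := mem_image.1 h
      · simpa using hI2 hn
      · rw [hu J' ⟨hJm', (hss _ _).1 hI1, (hss _ _).1 hI2⟩]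
    · obtain ⟨D, rfl⟩ := hsome C hn
      rw [card_map] at hC
      obtain ⟨J, ⟨hJm, hJ1, hJ2⟩, hu⟩ := hIu D hC
      refine ⟨(J.1.map .some, J.2.map .some), ⟨mem_union_left _ (mem_image_of_mem _ hJm),
        map_subset_map.2 hJ1, map_subset_map.2 hJ2⟩, ?_⟩
      rintro I ⟨hmem, hI1, hI2⟩
      rcases mem_union.1 hmem with h | h <;> obtain ⟨J', hJm', rfl⟩ := mem_image.1 h
      · rw [hu J' ⟨hJm', map_subset_map.1 hI1, map_subset_map.1 hI2⟩]
      · simpa using hI1 (none_mem_insertNone (s := J'.1))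

/-- Disjoint intervals are completed to a partition by edges `[C, φ C]` and singletons. -/
theorem HasIntervalPartition.of_partial {α : Type*} [Fintype α] {d s : ℕ}
    {𝓘 : Finset (Finset α × Finset α)}
    (h𝓘 : ∀ I ∈ 𝓘, I.1 ⊆ I.2 ∧ d ≤ I.1.card ∧ s ≤ I.2.card)
    (hdisj : ∀ C, ∀ I ∈ 𝓘, ∀ J ∈ 𝓘, I.1 ⊆ C → C ⊆ I.2 → J.1 ⊆ C → C ⊆ J.2 → I = J)
    {Covered : Finset α → Prop} (hcov : ∀ C, Covered C ↔ ∃ I ∈ 𝓘, I.1 ⊆ C ∧ C ⊆ I.2)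
    (hlow : ∀ C : Finset α, d ≤ C.card → ¬ Covered C → s ≤ C.card + 1)
    (φ : Finset α → Finset α)
    (hφ : ∀ C : Finset α, d ≤ C.card → ¬ Covered C → C.card + 1 = s →
      C ⊆ φ C ∧ (φ C).card = s ∧ ¬ Covered (φ C))
    (hinj : Set.InjOn φ {C | d ≤ C.card ∧ ¬ Covered C ∧ C.card + 1 = s}) :
    HasIntervalPartition α d s := by
  classical
  set U : Finset (Finset α) := univ.filter fun C => d ≤ C.card ∧ ¬ Covered C ∧ C.card + 1 = s with hU
  have hmemU (C : Finset α) : C ∈ U ↔ d ≤ C.card ∧ ¬ Covered C ∧ C.card + 1 = s := by simp [hU]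
  set V : Finset (Finset α) :=
    univ.filter fun C => d ≤ C.card ∧ ¬ Covered C ∧ s ≤ C.card ∧ C ∉ U.image φ with hV
  have hmemV (C : Finset α) :
      C ∈ V ↔ d ≤ C.card ∧ ¬ Covered C ∧ s ≤ C.card ∧ C ∉ U.image φ := by simp [hV]
  have hsq (C D : Finset α) (hC : C ∈ U) (h1 : C ⊆ D) (h2 : D ⊆ φ C) : D = C ∨ D = φ C := by
    rw [hmemU] at hC
    have h3 := hφ C hC.1 hC.2.1 hC.2.2
    rcases (card_le_card h1).eq_or_lt with h | h
    · exact Or.inl (eq_of_subset_of_card_le h1 h.ge).symm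
    · exact Or.inr (eq_of_subset_of_card_le h2 (by omega))
  have hmem (I : Finset α × Finset α) (C : Finset α)
      (hI : I ∈ 𝓘 ∪ U.image (fun C => (C, φ C)) ∪ V.image (fun C => (C, C)))
      (h1 : I.1 ⊆ C) (h2 : C ⊆ I.2) :
      (I ∈ 𝓘 ∧ Covered C) ∨
        (¬ Covered C ∧ ∃ D ∈ U, I = (D, φ D) ∧ (C = D ∨ C = φ D)) ∨
        (¬ Covered C ∧ C ∈ V ∧ I = (C, C)) := by
    simp only [mem_union, mem_image] at hI
    rcases hI with (hI | ⟨D, hD, rfl⟩) | ⟨D, hD, rfl⟩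
    · exact Or.inl ⟨hI, (hcov C).2 ⟨I, hI, h1, h2⟩⟩
    · refine Or.inr (Or.inl ⟨?_, D, hD, rfl, hsq D C hD h1 h2⟩)
      have hD' := (hmemU D).1 hD
      rcases hsq D C hD h1 h2 with rfl | rfl
      · exact hD'.2.1
      · exact (hφ D hD'.1 hD'.2.1 hD'.2.2).2.2
    · obtain rfl : D = C := subset_antisymm h1 h2
      exact Or.inr (Or.inr ⟨((hmemV D).1 hD).2.1, hD, rfl⟩)
  have hcardφ (D : Finset α) (hD : D ∈ U) : (φ D).card = s ∧ D.card + 1 = s := by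
    have hD' := (hmemU D).1 hD
    exact ⟨(hφ D hD'.1 hD'.2.1 hD'.2.2).2.1, hD'.2.2⟩
  refine ⟨𝓘 ∪ U.image (fun C => (C, φ C)) ∪ V.image (fun C => (C, C)), ?_, fun C hC => ?_⟩
  · intro I hI
    simp only [mem_union, mem_image] at hI
    rcases hI with (hI | ⟨D, hD, rfl⟩) | ⟨D, hD, rfl⟩
    · exact h𝓘 I hI
    · have hD' := (hmemU D).1 hD
      have := hφ D hD'.1 hD'.2.1 hD'.2.2
      exact ⟨this.1, hD'.1, this.2.1.ge⟩
    · have hD' := (hmemV D).1 hD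
      exact ⟨subset_rfl, hD'.1, hD'.2.2.1⟩
  · refine existsUnique_of_exists_of_unique ?_ ?_
    · by_cases hc : Covered C
      · obtain ⟨I, hI, h⟩ := (hcov C).1 hc
        exact ⟨I, by simp [hI], h⟩
      · rcases (hlow C hC hc).eq_or_lt with h | h
        · have hCU : C ∈ U := (hmemU C).2 ⟨hC, hc, h.symm⟩
          exact ⟨(C, φ C), mem_union_left _ (mem_union_right _ (mem_image_of_mem _ hCU)),
            subset_rfl, (hφ C hC hc h.symm).1⟩
        · by_cases hi : C ∈ U.image φ
          · obtain ⟨D, hD, rfl⟩ := mem_image.1 hi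
            have hD' := (hmemU D).1 hD
            exact ⟨(D, φ D), mem_union_left _ (mem_union_right _ (mem_image_of_mem _ hD)),
              (hφ D hD'.1 hD'.2.1 hD'.2.2).1, subset_rfl⟩
          · exact ⟨(C, C), mem_union_right _ (mem_image_of_mem _
              ((hmemV C).2 ⟨hC, hc, by omega, hi⟩)), subset_rfl, subset_rfl⟩
    · rintro I J ⟨hI, hI1, hI2⟩ ⟨hJ, hJ1, hJ2⟩
      rcases hmem I C hI hI1 hI2 with ⟨hIm, hc⟩ | ⟨hc, D, hD, rfl, hCD⟩ | ⟨hc, hCV, rfl⟩ <;>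
      rcases hmem J C hJ hJ1 hJ2 with ⟨hJm, hc'⟩ | ⟨hc', D', hD', rfl, hCD'⟩ | ⟨hc', hCV', rfl⟩
      · exact hdisj C I hIm J hJm hI1 hI2 hJ1 hJ2
      · exact absurd hc hc'
      · exact absurd hc hc'
      · exact absurd hc' hc
      · have h1 := hcardφ D hD
        have h2 := hcardφ D' hD'
        rcases hCD with rfl | rfl <;> rcases hCD' with h | h
        · rw [h]
        · rw [h] at h1; omega
        · rw [h] at h1; omega
        · rw [hinj ((hmemU D).1 hD) ((hmemU D').1 hD') h]
      · have h1 := hcardφ D hD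
        have h2 := (hmemV C).1 hCV'
        rcases hCD with rfl | rfl
        · omega
        · exact absurd (mem_image_of_mem φ hD) h2.2.2.2
      · exact absurd hc' hc
      · have h1 := hcardφ D' hD'
        have h2 := (hmemV C).1 hCV
        rcases hCD' with rfl | rfl
        · omega
        · exact absurd (mem_image_of_mem φ hD') h2.2.2.2
      · rfl

/-- Below the middle of the Boolean lattice, the sets with `r` elements can be enlarged by one
element in an injective way. -/
theorem exists_injOn_superset {α : Type*} [Fintype α] {r : ℕ} (h : 2 * r + 1 ≤ Fintype.card α) :
    ∃ φ : Finset α → Finset α, (∀ C : Finset α, C.card = r → C ⊆ φ C ∧ (φ C).card = r + 1) ∧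
      Set.InjOn φ {C | C.card = r} := by
  classical
  let t : {C : Finset α // C.card = r} → Finset (Finset α) := fun C =>
    univ.filter fun E => C.1 ⊆ E ∧ E.card = r + 1
  -- Hall's condition by double counting: an r-set has at least r + 1 supersets of size r + 1, and
  -- each of those contains at most r + 1 members of `S`.
  obtain ⟨f, hf, hft⟩ := (all_card_le_biUnion_card_iff_exists_injective t).1 fun S => by
    have key := card_mul_le_card_mul (s := S) (t := S.biUnion t) (fun C E => C.1 ⊆ E)
      (m := r + 1) (n := r + 1) ?_ ?_
    · exact Nat.le_of_mul_le_mul_right key (Nat.succ_pos r)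
    · rintro ⟨C, hC⟩ hCS
      have hle : r + 1 ≤ (Cᶜ).card := by rw [card_compl, hC]; omega
      refine hle.trans ?_
      rw [← card_image_of_injOn (f := fun x => insert x C) (s := Cᶜ)]
      · refine card_le_card fun E hE => ?_
        obtain ⟨x, hx, rfl⟩ := mem_image.1 hE
        rw [mem_compl] at hx
        simp only [mem_bipartiteAbove, mem_biUnion]
        exact ⟨⟨⟨C, hC⟩, hCS, by simp [t, hx, hC]⟩, subset_insert _ _⟩
      · intro x hx y hy hxy
        have hx' : x ∉ C := by simpa using hx
        have : x ∈ insert y C := by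
          have : insert x C = insert y C := hxy
          rw [← this]; exact mem_insert_self _ _
        exact (mem_insert.1 this).resolve_right hx'
    · intro E hE
      obtain ⟨C, hC, hEC⟩ := mem_biUnion.1 hE
      have hcard : E.card = r + 1 := by simpa [t] using (mem_filter.1 hEC).2.2
      calc (S.bipartiteBelow (fun C E => C.1 ⊆ E) E).card
          ≤ (powersetCard r E).card := by
            refine card_le_card_of_injOn Subtype.val (fun D hD => ?_) Subtype.val_injective.injOn
            exact mem_powersetCard.2 ⟨(mem_bipartiteBelow _).1 hD |>.2, D.2⟩
        _ = r + 1 := by rw [card_powersetCard, hcard, Nat.choose_succ_self_right]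
  refine ⟨fun C => if hC : C.card = r then f ⟨C, hC⟩ else C, fun C hC => ?_, ?_⟩
  · simpa [t, hC] using hft ⟨C, hC⟩
  · intro C hC D hD hCD
    have hC' : C.card = r := hC
    have hD' : D.card = r := hD
    simp only [hC', hD', dite_true] at hCD
    simpa using hf hCD

/-- The set `C` lies in one of the intervals `[A, A ∪ gaps k A]` with `|A| = d`. -/
def GapCovered {n : ℕ} [NeZero n] (k d : ℕ) (C : Finset (ZMod n)) : Prop :=
  ∃ A, A.card = d ∧ A ⊆ C ∧ C ⊆ A ∪ gaps k A

theorem gapCovered_of_card {n : ℕ} [NeZero n] {k d : ℕ} {C : Finset (ZMod n)} (hC : C.card = d) :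
    GapCovered k d C :=
  ⟨C, hC, subset_rfl, subset_union_left⟩

theorem eq_of_gapCovered {n : ℕ} [NeZero n] {k d : ℕ} (hn : n = (k + 1) * d + k)
    {A A' C : Finset (ZMod n)} (hA : A.card = d) (hA' : A'.card = d) (h1 : A ⊆ C)
    (h2 : C ⊆ A ∪ gaps k A) (h1' : A' ⊆ C) (h2' : C ⊆ A' ∪ gaps k A') : A = A' := by
  refine eq_of_union_gaps hn hA hA' (R := C \ A) (R' := C \ A') ?_ ?_ ?_
  · exact sdiff_le_iff.2 h2
  · exact sdiff_le_iff.2 h2'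
  · rw [union_sdiff_of_subset h1, union_sdiff_of_subset h1']

/-- The map (A, g) ↦ A ∪ {g} on gaps is injective by disjointness of the intervals. As n - d =
k(d+1), there are as many pairs as (d+1)-sets, so it is onto. -/
theorem gapCovered_of_card_eq_add_one {n : ℕ} [NeZero n] {k d : ℕ} (hn : n = (k + 1) * d + k)
    {C : Finset (ZMod n)} (hC : C.card = d + 1) : GapCovered k d C := by
  set P : Finset (Σ _ : Finset (ZMod n), ZMod n) :=
    (powersetCard d univ).sigma fun A => gaps k A with hP
  have hPm (p : Σ _ : Finset (ZMod n), ZMod n) : p ∈ P ↔ p.1.card = d ∧ p.2 ∈ gaps k p.1 := by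
    simp [hP, mem_powersetCard]
  have hPc : P.card = n.choose d * k := by
    rw [hP, card_sigma, sum_congr rfl fun A hA => card_gaps hn (mem_powersetCard.1 hA).2]
    simp [ZMod.card]
  have hmaps : ∀ p ∈ P, insert p.2 p.1 ∈ powersetCard (d + 1) (univ : Finset (ZMod n)) := by
    intro p hp
    rw [hPm] at hp
    simp [mem_powersetCard, card_insert_of_notMem (notMem_of_mem_gaps hp.2), hp.1]
  have hinj : Set.InjOn (fun p : Σ _ : Finset (ZMod n), ZMod n => insert p.2 p.1) P := by
    rintro ⟨A, g⟩ hp ⟨A', g'⟩ hp' h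
    rw [mem_coe, hPm] at hp hp'
    simp only at hp hp' h
    obtain rfl : A = A' := by
      refine eq_of_gapCovered hn (C := insert g A) hp.1 hp'.1 (subset_insert _ _) ?_ ?_ ?_
      · exact insert_subset (mem_union_right _ hp.2) subset_union_left
      · rw [h]; exact subset_insert _ _
      · rw [h]; exact insert_subset (mem_union_right _ hp'.2) subset_union_left
    have : g ∈ insert g' A := h ▸ mem_insert_self _ _
    rw [(mem_insert.1 this).resolve_right (notMem_of_mem_gaps hp.2)]
  have hcard : (powersetCard (d + 1) (univ : Finset (ZMod n))).card ≤ P.card := by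
    rw [hPc, card_powersetCard, card_univ, ZMod.card]
    refine Nat.le_of_mul_le_mul_right ?_ (Nat.succ_pos d)
    rw [Nat.choose_succ_right_eq, mul_assoc, show n - d = k * (d + 1) by
      rw [hn, Nat.sub_eq_of_eq_add]; ring]
  obtain ⟨⟨A, g⟩, hp, rfl⟩ := surj_on_of_inj_on_of_card_le (fun p _ => insert p.2 p.1) hmaps
    (fun p q hp hq h => hinj hp hq h) hcard C (by simp [mem_powersetCard, hC])
  rw [hPm] at hp
  exact ⟨A, hp.1, subset_insert _ _,
    insert_subset (mem_union_right _ hp.2) subset_union_left⟩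

/-- By cardinality E is the top of its interval. Deleting a gap stays in that interval; deleting a
point of A leads to the interval of the exchanged set. Contrapositively, enlarging an uncovered set
of size d + k - 1 by one point keeps it uncovered. -/
theorem GapCovered.of_insert {n : ℕ} [NeZero n] {k d : ℕ} (hn : n = (k + 1) * d + k) (hk : 1 ≤ k)
    {C E : Finset (ZMod n)} (hE : GapCovered k d E) (hcard : E.card = d + k) (hCE : C ⊆ E)
    (hC : C.card + 1 = d + k) : GapCovered k d C := by
  obtain ⟨A, hA, hAE, hEA⟩ := hE
  have hEeq : E = A ∪ gaps k A := by
    refine eq_of_subset_of_card_le hEA ?_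
    rw [card_union_of_disjoint (disjoint_gaps k A), hA, card_gaps hn hA, hcard]
  by_cases hAC : A ⊆ C
  · exact ⟨A, hA, hAC, hCE.trans hEA⟩
  obtain ⟨e, heA, heC⟩ := not_subset.1 hAC
  have hCeq : C = E.erase e := by
    refine eq_of_subset_of_card_le (fun x hx => mem_erase.2 ⟨?_, hCE hx⟩) ?_
    · rintro rfl; exact heC hx
    · rw [card_erase_of_mem (hAE heA)]; omega
  obtain ⟨g, hg, hgs⟩ := exists_exchange_gap (k := k) (A := A)
    (card_pos.1 (by rw [card_gaps hn hA]; exact hk)) heA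
  have hgA := notMem_of_mem_gaps hg
  refine ⟨insert g (A.erase e), ?_, ?_, ?_⟩
  · rw [card_insert_of_notMem (fun h => hgA (mem_of_mem_erase h)), card_erase_add_one heA, hA]
  · rw [hCeq, hEeq]
    intro x hx
    rcases mem_insert.1 hx with rfl | hx
    · exact mem_erase.2 ⟨fun h => hgA (h ▸ heA), mem_union_right _ hg⟩
    · exact mem_erase.2 ⟨ne_of_mem_erase hx, mem_union_left _ (mem_of_mem_erase hx)⟩
  · rw [hCeq, hEeq]
    intro x hx
    obtain ⟨hxe, hx⟩ := mem_erase.1 hx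
    rcases mem_union.1 hx with hx | hx
    · exact mem_union_left _ (mem_insert_of_mem (mem_erase.2 ⟨hxe, hx⟩))
    · by_cases hxg : x = g
      · exact mem_union_left _ (hxg ▸ mem_insert_self _ _)
      · exact mem_union_right _ (hgs (mem_erase.2 ⟨hxg, hx⟩))

theorem hasIntervalPartition_zmod {n : ℕ} [NeZero n] {k d : ℕ} (hn : n = (k + 1) * d + k)
    (hd : 1 ≤ d) (hk : k ≤ 3) : HasIntervalPartition (ZMod n) d (d + k) := by
  have hlow (C : Finset (ZMod n)) (hC : d ≤ C.card) (hc : ¬ GapCovered k d C) :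
      d + 2 ≤ C.card := by
    have h1 : C.card ≠ d := fun h => hc (gapCovered_of_card h)
    have h2 : C.card ≠ d + 1 := fun h => hc (gapCovered_of_card_eq_add_one hn h)
    omega
  obtain ⟨φ, hφ, hinj⟩ : ∃ φ : Finset (ZMod n) → Finset (ZMod n),
      (∀ C : Finset (ZMod n), d ≤ C.card → ¬ GapCovered k d C → C.card + 1 = d + k →
        C ⊆ φ C ∧ (φ C).card = d + k ∧ ¬ GapCovered k d (φ C)) ∧
      Set.InjOn φ {C | d ≤ C.card ∧ ¬ GapCovered k d C ∧ C.card + 1 = d + k} := by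
    rcases hk.lt_or_eq with hk | rfl
    -- For k ≤ 2 every set of size d + k - 1 in range is covered, so nothing needs matching.
    · refine ⟨id, fun C hC hc h => ?_, fun C hC => ?_⟩
      · have := hlow C hC hc; omega
      · have := hlow C hC.1 hC.2.1; have := hC.2.2; omega
    -- Size d + 2 lies below the middle of 4d + 3 points because d ≥ 1.
    · obtain ⟨φ, hφ, hinj⟩ := exists_injOn_superset (α := ZMod n) (r := d + 2)
        (by rw [ZMod.card]; omega)
      refine ⟨φ, fun C hC hc h => ?_, hinj.mono fun C hC => ?_⟩
      · obtain ⟨h1, h2⟩ := hφ C (by omega)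
        exact ⟨h1, h2, fun hcov => hc (hcov.of_insert hn (by norm_num) h2 h1 h)⟩
      · have := hC.2.2
        exact (by omega : C.card = d + 2)
  refine HasIntervalPartition.of_partial (Covered := GapCovered k d)
    (𝓘 := (powersetCard d univ).image fun A => (A, A ∪ gaps k A)) ?_ ?_ ?_ ?_ φ hφ hinj
  · intro I hI
    obtain ⟨A, hA, rfl⟩ := mem_image.1 hI
    have hA' := (mem_powersetCard.1 hA).2
    refine ⟨subset_union_left, hA'.ge, ?_⟩
    rw [card_union_of_disjoint (disjoint_gaps k A), hA', card_gaps hn hA']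
  · intro C I hI J hJ h1 h2 h3 h4
    obtain ⟨A, hA, rfl⟩ := mem_image.1 hI
    obtain ⟨A', hA', rfl⟩ := mem_image.1 hJ
    rw [eq_of_gapCovered hn (mem_powersetCard.1 hA).2 (mem_powersetCard.1 hA').2 h1 h2 h3 h4]
  · intro C
    simp [GapCovered, mem_powersetCard]
  · intro C hC hc
    have := hlow C hC hc
    omega

theorem hasIntervalPartition_fin {k : ℕ} (hk : k ≤ 3) (n d : ℕ) (h : (k + 1) * d + k ≤ n) :
    HasIntervalPartition (Fin n) d (d + k) := by
  induction n generalizing d with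
  | zero =>
    obtain rfl : d = 0 := by
      rw [Nat.le_zero, Nat.add_eq_zero_iff, Nat.mul_eq_zero] at h
      omega
    exact hasIntervalPartition_zero _ (by simp; omega)
  | succ n ih =>
    rcases d with _ | d
    · exact hasIntervalPartition_zero _ (by simp; omega)
    rcases h.eq_or_lt with h | h
    · exact hasIntervalPartition_zmod (n := n + 1) h.symm (by omega) hk
    -- Strict inequality leaves room to drop one point for d + 1; for d the requirement falls by k +
    -- 1 ≥ 1.
    · have h1 := ih (d + 1) (by omega)
      have h2 := ih d (by rw [mul_add] at h; omega)
      rw [show d + 1 + k = d + k + 1 by omega] at h1 ⊢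
      exact (h1.option h2).congr (finSuccEquiv n).symm

end IntervalPartition

/-! ### Stanley decompositions in terms of exponents -/

section Algebra

open MvPolynomial

variable {K : Type*} [Field K] {n : ℕ}

/-- The exponents of the monomials in `x^a K[Z]`. -/
def coneExponents (a : Fin n →₀ ℕ) (Z : Finset (Fin n)) : Set (Fin n →₀ ℕ) :=
  {c | a ≤ c ∧ ∀ i ∉ Z, c i = a i}

theorem stanleySpace_monomial (a : Fin n →₀ ℕ) {r : K} (hr : r ≠ 0) (Z : Finset (Fin n)) :
    stanleySpace (monomial a r) Z = restrictSupport K (coneExponents a Z) := by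
  apply le_antisymm
  · rintro _ ⟨g, hg, rfl⟩
    rw [mem_restrictSupport_iff]
    intro c hc
    have hg' : g ∈ supported K (Z : Set (Fin n)) := hg
    rw [mem_supported] at hg'
    rw [Finset.mem_coe, mem_support_iff, LinearMap.mulLeft_apply, coeff_monomial_mul'] at hc
    split_ifs at hc with hac
    · refine ⟨hac, fun i hi => ?_⟩
      by_contra hne
      have hmem : c - a ∈ g.support := mem_support_iff.2 (right_ne_zero_of_mul hc)
      refine hi (hg' ((mem_vars_iff_mem_support i).2 ⟨_, hmem, ?_⟩))
      have := hac i
      rw [Finsupp.mem_support_iff, Finsupp.tsub_apply]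
      omega
    · exact absurd rfl hc
  · rw [restrictSupport_eq_span, Submodule.span_le]
    rintro _ ⟨c, hc, rfl⟩
    refine ⟨monomial (c - a) r⁻¹, ?_, ?_⟩
    · change monomial (c - a) r⁻¹ ∈ supported K (Z : Set (Fin n))
      rw [mem_supported]
      intro i hi
      rw [Finset.mem_coe, vars_monomial (inv_ne_zero hr), Finsupp.mem_support_iff,
        Finsupp.tsub_apply] at hi
      by_contra hiZ
      exact hi (by rw [hc.2 i hiZ, tsub_self])
    · simp [monomial_mul, hr, add_tsub_cancel_of_le hc.1]

theorem restrictSupport_iUnion {ι : Sort*} (T : ι → Set (Fin n →₀ ℕ)) :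
    restrictSupport K (⋃ i, T i) = ⨆ i, restrictSupport K (T i) := by
  simp only [restrictSupport_eq_span, Set.image_iUnion, Submodule.span_iUnion]

theorem disjoint_restrictSupport_iff {s t : Set (Fin n →₀ ℕ)} :
    Disjoint (restrictSupport K s) (restrictSupport K t) ↔ Disjoint s t := by
  constructor
  · intro h
    rw [Set.disjoint_left]
    intro c hs ht
    have := Submodule.disjoint_def.1 h (monomial c 1) (by simp [hs]) (by simp [ht])
    simp at this
  · intro h
    rw [Submodule.disjoint_def]
    intro f hs ht
    rw [← support_eq_empty, Finset.eq_empty_iff_forall_notMem]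
    intro c hc
    exact Set.disjoint_left.1 h (hs hc) (ht hc)

/-- Spans of sets of monomials are independent as soon as the exponent sets are pairwise disjoint;
this makes decompositions purely combinatorial. -/
theorem iSupIndep_restrictSupport_iff {ι : Type*} {T : ι → Set (Fin n →₀ ℕ)} :
    iSupIndep (fun i => restrictSupport K (T i)) ↔ Pairwise (Function.onFun Disjoint T) := by
  constructor
  · intro h i j hij
    exact disjoint_restrictSupport_iff.1 (h.pairwiseDisjoint hij)
  · intro h i
    have hT : ⨆ j, ⨆ (_ : j ≠ i), restrictSupport K (T j) =
        restrictSupport K (⋃ j, ⋃ (_ : j ≠ i), T j) := by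
      simp only [restrictSupport_iUnion]
    rw [hT, disjoint_restrictSupport_iff]
    simp only [Set.disjoint_iUnion_right]
    exact fun j hj => h (Ne.symm hj)

theorem restrictSupport_injective :
    Function.Injective (restrictSupport K : Set (Fin n →₀ ℕ) → _) := by
  intro s t h
  ext c
  have : monomial c (1 : K) ∈ restrictSupport K s ↔ monomial c (1 : K) ∈ restrictSupport K t := by
    rw [h]
  simpa using this

/-- The multidegree of a monomial is its exponent vector, so only one exponent can occur. -/
theorem IsMultihomogeneous.exists_monomial {f : MvPolynomial (Fin n) K}
    (hf : IsMultihomogeneous f) (h0 : f ≠ 0) : ∃ a r, r ≠ 0 ∧ f = monomial a r := by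
  obtain ⟨b, hb⟩ := hf
  have hw (c : Fin n →₀ ℕ) (i : Fin n) :
      Finsupp.weight (fun i : Fin n => (Pi.single i 1 : Fin n → ℤ)) c i = c i := by
    rw [Finsupp.weight_apply, Finsupp.sum_fintype _ _ (by simp)]
    simp [Finset.sum_apply, Pi.single_apply]
  obtain ⟨a, ha⟩ := support_nonempty.2 h0
  have ha' := mem_support_iff.1 ha
  refine ⟨a, coeff a f, ha', ?_⟩
  ext c
  rw [coeff_monomial]
  split_ifs with h
  · rw [h]
  · by_contra hc
    refine h (Finsupp.ext fun i => ?_)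
    have := (hw a i).symm.trans ((congrFun ((hb ha').trans (hb hc).symm) i).trans (hw c i))
    exact_mod_cast this

theorem isMultihomogeneous_monomial (a : Fin n →₀ ℕ) (r : K) :
    IsMultihomogeneous (monomial a r) :=
  ⟨_, isWeightedHomogeneous_monomial _ _ _ rfl⟩

/-- The exponent vector of the squarefree monomial with support `A`. -/
noncomputable def indicatorExponent (A : Finset (Fin n)) : Fin n →₀ ℕ :=
  Finsupp.indicator A fun _ _ => 1

theorem indicatorExponent_apply (A : Finset (Fin n)) (i : Fin n) :
    indicatorExponent A i = if i ∈ A then 1 else 0 := by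
  simp [indicatorExponent, Finsupp.indicator_apply]

theorem support_indicatorExponent (A : Finset (Fin n)) : (indicatorExponent A).support = A := by
  ext i
  simp [indicatorExponent_apply]

theorem indicatorExponent_le_iff {A : Finset (Fin n)} {c : Fin n →₀ ℕ} :
    indicatorExponent A ≤ c ↔ A ⊆ c.support := by
  simp only [Finsupp.le_def, indicatorExponent_apply, Finset.subset_iff, Finsupp.mem_support_iff]
  refine forall_congr' fun i => ?_
  split_ifs with h <;> simp [h, Nat.one_le_iff_ne_zero]

theorem squarefreeVeronese_eq_restrictSupport (d : ℕ) :
    (squarefreeVeronese K n d).restrictScalars K = restrictSupport K {c | d ≤ c.support.card} := by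
  have h : squarefreeVeronese K n d = Ideal.span ((fun a => monomial a (1 : K)) ''
      (indicatorExponent '' {A : Finset (Fin n) | A.card = d})) := by
    rw [squarefreeVeronese, Set.image_image]
    congr 1
    ext f
    have hprod (A : Finset (Fin n)) :
        ∏ i ∈ A, (X i : MvPolynomial (Fin n) K) = monomial (indicatorExponent A) 1 := by
      have : indicatorExponent A = ∑ i ∈ A, Finsupp.single i 1 := by
        ext i
        simp [indicatorExponent_apply, Finsupp.single_apply]
      rw [this, monomial_sum_one]
      rfl
    simp only [hprod]
    exact exists_congr fun A => and_congr_right fun _ => eq_comm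
  ext f
  rw [Submodule.restrictScalars_mem, h, mem_ideal_span_monomial_image, mem_restrictSupport_iff]
  refine forall₂_congr fun c _ => ?_
  constructor
  · rintro ⟨_, ⟨A, hA, rfl⟩, hAc⟩
    exact (show A.card = d from hA) ▸ Finset.card_le_card (indicatorExponent_le_iff.1 hAc)
  · intro hc
    obtain ⟨A, hAc, hA⟩ := Finset.exists_subset_card_eq hc
    exact ⟨_, ⟨A, hA, rfl⟩, indicatorExponent_le_iff.2 hAc⟩

theorem mem_coneExponents_indicatorExponent {A B : Finset (Fin n)} (hAB : A ⊆ B)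
    {c : Fin n →₀ ℕ} :
    c ∈ coneExponents (indicatorExponent A) B ↔ A ⊆ c.support ∧ c.support ⊆ B := by
  change _ ∧ _ ↔ _
  rw [indicatorExponent_le_iff]
  refine and_congr_right fun _ => ⟨fun h i hi => ?_, fun h i hi => ?_⟩
  · by_contra hiB
    have := h i hiB
    rw [indicatorExponent_apply, if_neg fun hA => hiB (hAB hA)] at this
    exact Finsupp.mem_support_iff.1 hi this
  · rw [indicatorExponent_apply, if_neg fun hA => hi (hAB hA)]
    by_contra hc
    exact hi (h (Finsupp.mem_support_iff.2 hc))

theorem exists_stanleyDecomposition {d s : ℕ} (hdn : d ≤ n)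
    (h : HasIntervalPartition (Fin n) d s) :
    ∃ D : StanleyDecomposition (squarefreeVeronese K n d), s ≤ D.sdepth := by
  obtain ⟨𝓘, hI, hu⟩ := h
  let e := 𝓘.equivFin.symm
  have hspace (i : Fin 𝓘.card) :
      stanleySpace (monomial (indicatorExponent (e i).1.1) (1 : K)) (e i).1.2 =
        restrictSupport K {c | (e i).1.1 ⊆ c.support ∧ c.support ⊆ (e i).1.2} := by
    rw [stanleySpace_monomial _ one_ne_zero]
    congr 1
    ext c
    exact mem_coneExponents_indicatorExponent (hI _ (e i).2).1
  have hveronese := squarefreeVeronese_eq_restrictSupport (K := K) (n := n) d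
  let D : StanleyDecomposition (squarefreeVeronese K n d) :=
    { m := 𝓘.card
      u := fun i => monomial (indicatorExponent (e i).1.1) 1
      Z := fun i => (e i).1.2
      mem := fun i => by
        rw [← Submodule.restrictScalars_mem K, hveronese, monomial_mem_restrictSupport]
        left
        simpa [support_indicatorExponent] using (hI _ (e i).2).2.1
      ne_zero := fun i => by simp
      homogeneous := fun i => isMultihomogeneous_monomial _ _
      independent := by
        simp only [hspace]
        rw [iSupIndep_restrictSupport_iff]
        intro i j hij
        refine Set.disjoint_left.2 fun c hi hj => hij (e.injective (Subtype.ext ?_))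
        exact (hu c.support ((hI _ (e i).2).2.1.trans (Finset.card_le_card hi.1))).unique
          ⟨(e i).2, hi⟩ ⟨(e j).2, hj⟩
      iSup_eq := by
        simp only [hspace]
        rw [← restrictSupport_iUnion, hveronese]
        congr 1
        ext c
        simp only [Set.mem_iUnion]
        constructor
        · rintro ⟨i, hi⟩
          exact (hI _ (e i).2).2.1.trans (Finset.card_le_card hi.1)
        · intro hc
          obtain ⟨I, ⟨hm, h1, h2⟩, -⟩ := hu c.support hc
          exact ⟨e.symm ⟨I, hm⟩, by simpa using ⟨h1, h2⟩⟩ }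
  refine ⟨D, ?_⟩
  -- An infimum over no summands would be 0, so one summand must be exhibited.
  obtain ⟨I, ⟨hm, -⟩, -⟩ := hu Finset.univ (by simpa using hdn)
  have : Nonempty (Fin D.m) := ⟨e.symm ⟨I, hm⟩⟩
  exact le_ciInf fun i => (hI _ (e i).2).2.2

/-- Double counting of pairs (A, x), where x is a variable outside A in the summand generated by
x^A: each A has at least sdepth - d of them, and they inject into the (d+1)-sets. -/
theorem StanleyDecomposition.sdepth_le {d : ℕ} (hdn : d ≤ n)
    (D : StanleyDecomposition (squarefreeVeronese K n d)) :
    D.sdepth ≤ n.choose (d + 1) / n.choose d + d := by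
  choose a r hr hu using fun i => (D.homogeneous i).exists_monomial (D.ne_zero i)
  have hspace (i) : stanleySpace (D.u i) (D.Z i) =
      restrictSupport K (coneExponents (a i) (D.Z i)) := by
    rw [hu, stanleySpace_monomial _ (hr i)]
  have hind := D.independent
  have hsup := D.iSup_eq
  simp only [hspace] at hind hsup
  rw [iSupIndep_restrictSupport_iff] at hind
  rw [← restrictSupport_iUnion, squarefreeVeronese_eq_restrictSupport] at hsup
  have hcover := restrictSupport_injective hsup
  have hmem (i) : d ≤ (a i).support.card := by
    have : a i ∈ ⋃ i, coneExponents (a i) (D.Z i) :=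
      Set.mem_iUnion.2 ⟨i, le_rfl, fun _ _ => rfl⟩
    rw [hcover] at this
    exact this
  have hex (A : Finset (Fin n)) (hA : A.card = d) : ∃ i, a i = indicatorExponent A := by
    have : indicatorExponent A ∈ ⋃ i, coneExponents (a i) (D.Z i) := by
      rw [hcover]
      simp [support_indicatorExponent, hA]
    obtain ⟨i, hi, -⟩ := Set.mem_iUnion.1 this
    -- The generator divides x^A and has support of size at least d, hence equals x^A up to a
    -- scalar.
    refine ⟨i, le_antisymm hi (indicatorExponent_le_iff.2 ?_)⟩
    have hsub : (a i).support ⊆ A := by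
      rw [← support_indicatorExponent A]
      exact Finsupp.support_mono hi
    rw [Finset.eq_of_subset_of_card_le hsub (hA.trans_le (hmem i))]
  obtain ⟨A₀, -, hA₀⟩ := Finset.exists_subset_card_eq (s := (Finset.univ : Finset (Fin n)))
    (n := d) (by simpa using hdn)
  have : Nonempty (Fin D.m) := ⟨(hex A₀ hA₀).choose⟩
  choose! ι hι using hex
  let P : Finset (Σ _ : Finset (Fin n), Fin n) :=
    (Finset.powersetCard d Finset.univ).sigma fun A => D.Z (ι A) \ A
  have hPm (p : Σ _ : Finset (Fin n), Fin n) :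
      p ∈ P ↔ p.1.card = d ∧ p.2 ∈ D.Z (ι p.1) ∧ p.2 ∉ p.1 := by
    simp [P, Finset.mem_powersetCard]
  have hle : P.card ≤ n.choose (d + 1) := by
    have : n.choose (d + 1) =
        (Finset.powersetCard (d + 1) (Finset.univ : Finset (Fin n))).card := by simp
    rw [this]
    refine Finset.card_le_card_of_injOn (fun p => insert p.2 p.1) ?_ ?_
    · intro p hp
      rw [Finset.mem_coe, hPm] at hp
      simp [Finset.mem_powersetCard, Finset.card_insert_of_notMem hp.2.2, hp.1]
    -- The monomial of A ∪ {x} lies in the summand of A, so disjointness of summands recovers A, and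
    -- then x.
    · have hcone (p) (hp : p ∈ P) : indicatorExponent (insert p.2 p.1) ∈
          coneExponents (a (ι p.1)) (D.Z (ι p.1)) := by
        rw [hPm] at hp
        rw [hι p.1 hp.1]
        refine ⟨indicatorExponent_le_iff.2 ?_, fun i hi => ?_⟩
        · rw [support_indicatorExponent]; exact Finset.subset_insert _ _
        · have : i ≠ p.2 := fun h => hi (h ▸ hp.2.1)
          simp [indicatorExponent_apply, this]
      intro p hp q hq h
      have h1 := hcone p hp
      have h2 := hcone q hq
      simp only at h
      rw [← h] at h2
      rw [Finset.mem_coe, hPm] at hp hq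
      have hpq : ι p.1 = ι q.1 := by
        by_contra hne
        exact Set.disjoint_left.1 (hind hne) h1 h2
      have h3 : p.1 = q.1 := by
        rw [← support_indicatorExponent p.1, ← hι p.1 hp.1, hpq, hι q.1 hq.1,
          support_indicatorExponent]
      obtain ⟨A, x⟩ := p
      obtain ⟨B, y⟩ := q
      obtain rfl : A = B := h3
      have : x ∈ insert y A := h ▸ Finset.mem_insert_self _ _
      rw [(Finset.mem_insert.1 this).resolve_right hp.2.2]
  have hge : n.choose d * (D.sdepth - d) ≤ P.card := by
    rw [Finset.card_sigma]
    have : n.choose d = (Finset.powersetCard d (Finset.univ : Finset (Fin n))).card := by simp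
    rw [this, ← smul_eq_mul]
    refine Finset.card_nsmul_le_sum _ _ _ fun A hA => ?_
    have hA' := (Finset.mem_powersetCard.1 hA).2
    have h1 : D.sdepth ≤ (D.Z (ι A)).card := ciInf_le (OrderBot.bddBelow _) _
    have h2 := Finset.le_card_sdiff A (D.Z (ι A))
    omega
  have : D.sdepth - d ≤ n.choose (d + 1) / n.choose d := by
    rw [Nat.le_div_iff_mul_le (Nat.choose_pos hdn), mul_comm]
    exact hge.trans hle
  omega

theorem sdepth_squarefreeVeronese_le {d : ℕ} (hdn : d ≤ n) :
    sdepth (squarefreeVeronese K n d) ≤ n.choose (d + 1) / n.choose d + d := by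
  rcases isEmpty_or_nonempty (StanleyDecomposition (squarefreeVeronese K n d)) with h | h
  -- Without decompositions the supremum takes its default value 0.
  · simp [sdepth, Set.range_eq_empty]
  · refine csSup_le (Set.range_nonempty _) ?_
    rintro _ ⟨D, rfl⟩
    exact D.sdepth_le hdn

theorem HasIntervalPartition.le_sdepth {d s : ℕ} (hdn : d ≤ n)
    (h : HasIntervalPartition (Fin n) d s) : s ≤ sdepth (squarefreeVeronese K n d) := by
  obtain ⟨D, hD⟩ := exists_stanleyDecomposition (K := K) hdn h
  refine hD.trans (le_csSup ⟨n.choose (d + 1) / n.choose d + d, ?_⟩ ⟨D, rfl⟩)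
  rintro _ ⟨D, rfl⟩
  exact D.sdepth_le hdn

end Algebra

end StanleyDepth

theorem theorem1p1 {K : Type*} [Field K] (n d : ℕ) :
    (1 ≤ d → d ≤ n → n < 5 * d + 4 →
      StanleyDepth.sdepth (StanleyDepth.squarefreeVeronese K n d) =
        ⌊(n.choose (d + 1) : ℚ) / (n.choose d : ℚ)⌋₊ + d) ∧
    (1 ≤ d → 5 * d + 4 ≤ n →
      d + 3 ≤ StanleyDepth.sdepth (StanleyDepth.squarefreeVeronese K n d) ∧
      StanleyDepth.sdepth (StanleyDepth.squarefreeVeronese K n d) ≤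
        ⌊(n.choose (d + 1) : ℚ) / (n.choose d : ℚ)⌋₊ + d) := by
  rw [Nat.floor_div_eq_div]
  refine ⟨fun _ hdn hn => le_antisymm (StanleyDepth.sdepth_squarefreeVeronese_le hdn) ?_,
    fun _ hn => ⟨?_, StanleyDepth.sdepth_squarefreeVeronese_le (by omega)⟩⟩
  · set k := n.choose (d + 1) / n.choose d with hk
    have hmul : (k * n.choose d) * (d + 1) ≤ (n - d) * n.choose d := by
      rw [mul_comm (n - d), ← Nat.choose_succ_right_eq]
      exact Nat.mul_le_mul_right _ (Nat.div_mul_le_self _ _)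
    -- The ratio of the binomials is (n - d)/(d + 1).
    have hkd : k * (d + 1) ≤ n - d := by
      refine Nat.le_of_mul_le_mul_right ?_ (Nat.choose_pos hdn)
      calc k * (d + 1) * n.choose d = (k * n.choose d) * (d + 1) := by ring
        _ ≤ _ := hmul
    have hk3 : k ≤ 3 := by
      by_contra hcon
      have : 4 * (d + 1) ≤ k * (d + 1) := Nat.mul_le_mul_right _ (by omega)
      omega
    rw [add_comm]
    refine (StanleyDepth.hasIntervalPartition_fin hk3 n d ?_).le_sdepth hdn
    calc (k + 1) * d + k = k * (d + 1) + d := by ring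
      _ ≤ n := by omega
  -- Here k = 3, which needs only 4d + 3 ≤ n.
  · exact (StanleyDepth.hasIntervalPartition_fin le_rfl n d (by omega)).le_sdepth (by omega)
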